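/- Let $n\ge 1$ and $d_1,\dots,d_n\ge 1$ be integers, put $\mathcal R=[d_1]\times\cdots\times[d_n]$, and let $G$ be the star graph on the vertex set $\{1,\dots,n\}$ with center $1$, that is, the graph whose edges are exactly $\{1,i\}$ for $2\le i\le n$. Let $\mathcal C(G)$ be the set of maximal cliques of $G$, and let $\mathcal M_G\subseteq\mathbb P^{d_1\cdots d_n-1}$ be the parametrized undirected graphical model of $G$: the projective toric variety that is the Zariski closure of the set of points $(p_j)_{j\in\mathcal R}$ of complex projective space of the form $$p_{j}=\prod_{C\in\mathcal C(G)}\sigma^{(C)}_{j_C}\quad(j\in\mathcal R),$$ where for each $C\in\mathcal C(G)$ the vector $\sigma^{(C)}\in\mathbb C^{\prod_{i\in C}[d_i]}$ is arbitrary and $j_C=(j_i)_{i\in C}$. Then the degree of the projective variety $\mathcal M_G$ (its dimension factorial times the leading coefficient of its Hilbert polynomial) is $$\deg(\mathcal M_G)=\left(\frac{\Big(\sum_{i=2}^n(d_i-1)\Big)!}{\prod_{i=2}^n(d_i-1)!}\right)^{d_1}.$$ -/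

import Mathlib

open scoped LinearAlgebra.Projectivization Nat

namespace GraphicalDegree

section ProjectiveSets

variable {σ : Type*}

/-- The affine cone, without its vertex, over a set of points of the complex projective space with
homogeneous coordinates indexed by `σ`. -/
def affineCone (X : Set (ℙ ℂ (σ → ℂ))) : Set (σ → ℂ) :=
  {v | ∃ hv : v ≠ 0, Projectivization.mk ℂ v hv ∈ X}

/-- The homogeneous vanishing ideal `I(X)`: the polynomials that vanish at all homogeneous
coordinate vectors of all points of `X`. (As the cone is stable under nonzero scaling and `ℂ` is
infinite, this ideal is generated by the homogeneous polynomials that vanish on `X`.) -/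
noncomputable def homVanishingIdeal (X : Set (ℙ ℂ (σ → ℂ))) : Ideal (MvPolynomial σ ℂ) :=
  MvPolynomial.vanishingIdeal ℂ (affineCone X)

/-- The Zariski closure of a set of points of projective space. -/
def zariskiClosure (X : Set (ℙ ℂ (σ → ℂ))) : Set (ℙ ℂ (σ → ℂ)) :=
  {p | ∀ f ∈ homVanishingIdeal X, MvPolynomial.eval p.rep f = 0}

/-- The Hilbert function of `X`: the dimension of the degree-`t` part of the homogeneous
coordinate ring `ℂ[x_s : s ∈ σ] / I(X)`. -/
noncomputable def hilbertFunction (X : Set (ℙ ℂ (σ → ℂ))) (t : ℕ) : ℕ :=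
  Module.finrank ℂ ((MvPolynomial.homogeneousSubmodule σ ℂ t).map
    (Ideal.Quotient.mkₐ ℂ (homVanishingIdeal X)).toLinearMap)

/-- `P` is the Hilbert polynomial of `X`. -/
def IsHilbertPolynomial (X : Set (ℙ ℂ (σ → ℂ))) (P : Polynomial ℚ) : Prop :=
  ∀ᶠ t : ℕ in Filter.atTop, P.eval (t : ℚ) = (hilbertFunction X t : ℚ)

/-- The projective variety `X` has degree `δ`: its Hilbert polynomial `P` exists, and `δ` is `r !`
times the leading coefficient of `P`, where `r`, the degree of `P`, is the dimension of `X`. -/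
def HasDegree (X : Set (ℙ ℂ (σ → ℂ))) (δ : ℚ) : Prop :=
  ∃ P : Polynomial ℚ, IsHilbertPolynomial X P ∧ δ = (P.natDegree ! : ℚ) * P.leadingCoeff

/-- The Hilbert polynomial is unique. -/
theorem IsHilbertPolynomial.unique {X : Set (ℙ ℂ (σ → ℂ))} {P Q : Polynomial ℚ}
    (hP : IsHilbertPolynomial X P) (hQ : IsHilbertPolynomial X Q) : P = Q := by
  obtain ⟨N, hN⟩ := Filter.eventually_atTop.1 (hP.and hQ)
  refine Polynomial.eq_of_infinite_eval_eq P Q ?_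
  refine ((Set.Ici_infinite N).image (f := fun t : ℕ => (t : ℚ))
    (Nat.cast_injective.injOn)).mono ?_
  rintro _ ⟨t, ht, rfl⟩
  exact (hN t ht).1.trans (hN t ht).2.symm

/-- The degree is unique. -/
theorem HasDegree.unique {X : Set (ℙ ℂ (σ → ℂ))} {δ ε : ℚ}
    (hδ : HasDegree X δ) (hε : HasDegree X ε) : δ = ε := by
  obtain ⟨P, hP, rfl⟩ := hδ
  obtain ⟨Q, hQ, rfl⟩ := hε
  rw [hP.unique hQ]

end ProjectiveSets

section GraphicalModels

variable {V : Type*} [Fintype V]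

/-- The set of maximal cliques of a graph. -/
noncomputable def maximalCliques (G : SimpleGraph V) : Finset (Finset V) := by
  classical
  exact Finset.univ.filter fun C => Maximal (fun s : Finset V => G.IsClique (s : Set V)) C

/-- The joint states of the random variables attached to the vertices in `C`, the one at the
vertex `i` having `d i` states. -/
abbrev CliqueState (d : V → ℕ) (C : Finset V) : Type _ := ∀ i : C, Fin (d i)

/-- The monomial parametrization: the coordinate at the joint state `j` is the product, over the
maximal cliques `C`, of the parameter of `C` at the restriction of `j` to `C`. -/
noncomputable def monomialParam (d : V → ℕ) (G : SimpleGraph V)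
    (s : ∀ C : Finset V, CliqueState d C → ℂ) (j : ∀ i, Fin (d i)) : ℂ :=
  ∏ C ∈ maximalCliques G, s C (fun i => j i)

/-- The point `p` of projective space factorizes according to `G`. -/
def FactorizesAccordingTo (d : V → ℕ) (G : SimpleGraph V)
    (p : ℙ ℂ ((∀ i, Fin (d i)) → ℂ)) : Prop :=
  ∃ (s : ∀ C : Finset V, CliqueState d C → ℂ) (hs : monomialParam d G s ≠ 0),
    p = Projectivization.mk ℂ (monomialParam d G s) hs

/-- The parametrized undirected graphical model `𝓜_G`: the projective toric variety of the
monomial parametrization, that is, the Zariski closure of its image. -/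
def graphicalModel (d : V → ℕ) (G : SimpleGraph V) : Set (ℙ ℂ ((∀ i, Fin (d i)) → ℂ)) :=
  zariskiClosure {p | FactorizesAccordingTo d G p}

end GraphicalModels

end GraphicalDegree

/-! Write `e i` for the number of states of leaf `i` minus one. The vanishing ideal of the model is
the kernel of a monomial map, so the Hilbert function at `t` counts sums of `t` generating exponents
(`hilbertFunction_zariskiClosure_toric`). For the star these sums are exactly the tables satisfying
balance equations: split `t` into counts `l a` over the states of the center, then for each `a` and
each leaf split `l a` over the states of that leaf (`mem_toricExponents_starExponent`). Once `a` is
fixed the leaves are independent, so the Hilbert series is the `d 0`-th power of that of a Segre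
product, `∑ₛ ∏ᵢ (s + e i).choose (e i) Xˢ` (`card_starExponents`). That series is `h / (1 - X) ^ (∑
e i + 1)` with `h(1) = (∑ e i)! / ∏ (e i)!`. Its power has numerator `h ^ d 0`, whose value at 1 is
the degree (`exists_polynomial_coeff_pow`). -/

namespace GraphicalDegree

/-! ### Rational generating series and normalized leading coefficients. -/

section HilbertSeries

open Polynomial PowerSeries

/-- The generating series of the values of a polynomial of degree at most `n` is a rational
function with denominator `(1 - X) ^ (n + 1)`. -/
theorem exists_numerator (n : ℕ) (P : ℚ[X]) (hP : P.natDegree ≤ n) :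
    ∃ h : ℚ[X], (PowerSeries.mk fun t : ℕ => P.eval (t : ℚ)) =
      (h : ℚ⟦X⟧) * (invOneSubPow ℚ (n + 1) : ℚ⟦X⟧) ∧ h.eval 1 = n ! * P.coeff n := by
  induction n generalizing P with
  | zero =>
    obtain ⟨c, rfl⟩ : ∃ c, P = Polynomial.C c := ⟨_, Polynomial.eq_C_of_natDegree_le_zero hP⟩
    refine ⟨Polynomial.C c, ?_, by simp⟩
    ext t
    rw [invOneSubPow_val_succ_eq_mk_add_choose, Polynomial.coe_C, PowerSeries.coeff_C_mul]
    simp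
  | succ n ih =>
    -- `preHilbertPoly ℚ (n + 1) 0` is `(t + n + 1).choose (n + 1)`, with leading coefficient `1 /
    -- (n + 1)!`, so this `c` cancels the top coefficient of `P`.
    set c : ℚ := (n + 1)! * P.coeff (n + 1) with hc
    set Q : ℚ[X] := P - c • preHilbertPoly ℚ (n + 1) 0 with hQ
    have hne : ((n + 1)! : ℚ) ≠ 0 := by positivity
    have hQd : Q.natDegree ≤ n := by
      rw [Polynomial.natDegree_le_iff_coeff_eq_zero]
      intro N hN
      rcases (Nat.succ_le_of_lt hN).eq_or_lt with rfl | hlt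
      · rw [hQ, Polynomial.coeff_sub, Polynomial.coeff_smul, Nat.succ_eq_add_one,
          coeff_preHilbertPoly_self, hc, smul_eq_mul]
        field_simp
        ring
      · refine Polynomial.coeff_eq_zero_of_natDegree_lt (lt_of_le_of_lt ?_ hlt)
        refine (Polynomial.natDegree_sub_le _ _).trans (max_le hP ?_)
        exact (Polynomial.natDegree_smul_le _ _).trans (natDegree_preHilbertPoly ℚ (n + 1) 0).le
    obtain ⟨h, h1, -⟩ := ih Q hQd
    -- The factor `1 - X` raises the denominator of the series of `Q` and vanishes at 1, so only `c`
    -- survives there.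
    refine ⟨Polynomial.C c + (1 - Polynomial.X) * h, ?_, by simp [hc]⟩
    have hinv := one_sub_pow_mul_invOneSubPow_val_add_eq_invOneSubPow_val ℚ (n + 1) 1
    have key : (PowerSeries.mk fun t : ℕ => P.eval (t : ℚ)) =
        (PowerSeries.mk fun t : ℕ => Q.eval (t : ℚ)) +
          PowerSeries.C c * (invOneSubPow ℚ (n + 1 + 1) : ℚ⟦X⟧) := by
      ext t
      rw [invOneSubPow_val_succ_eq_mk_add_choose, map_add, PowerSeries.coeff_C_mul]
      simp only [PowerSeries.coeff_mk, hQ, Polynomial.eval_sub, Polynomial.eval_smul]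
      rw [preHilbertPoly_eq_choose_sub_add ℚ (n + 1) (Nat.zero_le t), Nat.sub_zero, add_comm t]
      simp
    rw [key, h1, ← hinv]
    push_cast
    ring

/-- A numerator that is nonzero at 1 cancels no factor of the denominator. -/
theorem natDegree_hilbertPoly_of_eval_one_ne_zero (h : ℚ[X]) (hh : h.eval 1 ≠ 0) (N : ℕ) :
    (hilbertPoly h (N + 1)).natDegree = N := by
  have h0 : h ≠ 0 := by rintro rfl; simp at hh
  have h1 : h.rootMultiplicity 1 = 0 := Polynomial.rootMultiplicity_eq_zero hh
  rw [natDegree_hilbertPoly_of_ne_zero_of_rootMultiplicity_lt h0 (by omega), h1]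
  omega

/-- Every shifted binomial polynomial has top coefficient `1 / N !`, so the coefficients of `h` are
simply added up. -/
theorem coeff_hilbertPoly_succ (h : ℚ[X]) (N : ℕ) :
    (hilbertPoly h (N + 1)).coeff N = h.eval 1 / N ! := by
  rw [hilbertPoly_succ, Polynomial.finsetSum_coeff, Polynomial.eval_eq_sum, Polynomial.sum_def,
    Finset.sum_div]
  refine Finset.sum_congr rfl fun i _ => ?_
  rw [Polynomial.coeff_smul, coeff_preHilbertPoly_self, smul_eq_mul, one_pow, mul_one,
    div_eq_mul_inv]

/-- The coefficients of the `k`-th power of the Hilbert series of a Segre product of projective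
spaces of dimensions `e i` agree eventually with a polynomial of normalized leading coefficient
`((∑ e i)! / ∏ (e i)!) ^ k`. -/
theorem exists_polynomial_coeff_pow {ι : Type*} [Fintype ι] (e : ι → ℕ) (k : ℕ) (hk : k ≠ 0) :
    ∃ P : ℚ[X],
      (∀ᶠ t : ℕ in Filter.atTop, P.eval (t : ℚ) = PowerSeries.coeff t
        ((PowerSeries.mk fun s : ℕ => ∏ i, ((s + e i).choose (e i) : ℚ)) ^ k)) ∧
      (((∑ i, e i)! : ℚ) / ∏ i, ((e i)! : ℚ)) ^ k = (P.natDegree ! : ℚ) * P.leadingCoeff := by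
  set F : ℚ[X] := ∏ i, preHilbertPoly ℚ (e i) 0 with hF
  have hlc : ∀ i, (preHilbertPoly ℚ (e i) 0).leadingCoeff ≠ 0 := fun i => by
    rw [leadingCoeff_preHilbertPoly]; positivity
  have hdeg : F.natDegree = ∑ i, e i := by
    rw [hF, Polynomial.natDegree_prod _ _ fun i _ => Polynomial.leadingCoeff_ne_zero.1 (hlc i)]
    exact Finset.sum_congr rfl fun i _ => natDegree_preHilbertPoly ℚ _ _
  have hFl : F.coeff (∑ i, e i) = (∏ i, ((e i)! : ℚ))⁻¹ := by
    rw [← hdeg, Polynomial.coeff_natDegree, hF, Polynomial.leadingCoeff_prod,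
      ← Finset.prod_inv_distrib]
    exact Finset.prod_congr rfl fun i _ => leadingCoeff_preHilbertPoly ℚ _ _
  obtain ⟨h, h1, h2⟩ := exists_numerator _ F hdeg.le
  rw [hFl, ← div_eq_mul_inv] at h2
  have hmk : (PowerSeries.mk fun s : ℕ => ∏ i, ((s + e i).choose (e i) : ℚ)) =
      PowerSeries.mk fun t : ℕ => F.eval (t : ℚ) := by
    ext t
    simp only [PowerSeries.coeff_mk, hF, Polynomial.eval_prod]
    refine Finset.prod_congr rfl fun i _ => ?_
    rw [preHilbertPoly_eq_choose_sub_add ℚ _ (Nat.zero_le t), Nat.sub_zero]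
  have hinv : ∀ a b : ℕ, (invOneSubPow ℚ a : ℚ⟦X⟧) ^ b = (invOneSubPow ℚ (a * b) : ℚ⟦X⟧) := by
    intro a b
    induction b with
    | zero => simp [invOneSubPow_zero]
    | succ b ih => rw [pow_succ, ih, Nat.mul_succ, invOneSubPow_add, Units.val_mul]
  obtain ⟨N, hN⟩ : ∃ N, ((∑ i, e i) + 1) * k = N + 1 :=
    Nat.exists_eq_succ_of_ne_zero (by positivity)
  have hval : (h ^ k).eval 1 = (((∑ i, e i)! : ℚ) / ∏ i, ((e i)! : ℚ)) ^ k := by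
    rw [Polynomial.eval_pow, h2]
  have hne : (h ^ k).eval 1 ≠ 0 := by
    rw [hval]
    exact pow_ne_zero _ (div_ne_zero (by positivity) (Finset.prod_ne_zero_iff.2 fun i _ => by
      positivity))
  refine ⟨hilbertPoly (h ^ k) (N + 1), ?_, ?_⟩
  · filter_upwards [Filter.eventually_gt_atTop (h ^ k).natDegree] with t ht
    rw [← coeff_mul_invOneSubPow_eq_hilbertPoly_eval _ ht, hmk, h1, mul_pow, hinv, hN]
    push_cast
    rfl
  · rw [Polynomial.leadingCoeff, natDegree_hilbertPoly_of_eval_one_ne_zero _ hne,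
      coeff_hilbertPoly_succ, hval]
    have : (N ! : ℚ) ≠ 0 := by positivity
    field_simp

end HilbertSeries

/-! ### Projective toric varieties and their Hilbert functions. -/

section Toric

open MvPolynomial

variable {J W : Type*}

/-- The closure tests only the chosen representative of a point, the ideal all its coordinate
vectors. Stability of the ideal under rescaling the variables bridges the two. -/
theorem homVanishingIdeal_zariskiClosure (X : Set (ℙ ℂ (J → ℂ))) :
    homVanishingIdeal (zariskiClosure X) = homVanishingIdeal X := by
  have hscale : ∀ (f : MvPolynomial J ℂ), f ∈ homVanishingIdeal X → ∀ c : ℂ, c ≠ 0 →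
      bind₁ (fun j => C c * MvPolynomial.X j) f ∈ homVanishingIdeal X := by
    rintro f hf c hc
    rw [homVanishingIdeal, mem_vanishingIdeal_iff] at hf ⊢
    rintro v ⟨hv, hvX⟩
    rw [aeval_bind₁]
    have hcv : c • v ≠ 0 := smul_ne_zero hc hv
    have := hf (c • v) ⟨hcv, by
      rwa [(Projectivization.mk_eq_mk_iff' ℂ (c • v) v hcv hv).2 ⟨c, rfl⟩]⟩
    convert this using 2
    congr 1
    funext j
    simp
  apply le_antisymm
  · refine vanishingIdeal_anti_mono ?_
    rintro v ⟨hv, hvX⟩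
    refine ⟨hv, fun f hf => ?_⟩
    rw [homVanishingIdeal, mem_vanishingIdeal_iff] at hf
    have := hf (Projectivization.mk ℂ v hv).rep ⟨Projectivization.rep_nonzero _, by
      rwa [Projectivization.mk_rep]⟩
    rwa [← MvPolynomial.aeval_eq_eval]
  · intro f hf
    rw [homVanishingIdeal, mem_vanishingIdeal_iff]
    rintro v ⟨hv, hvX⟩
    obtain ⟨c, hc⟩ := Projectivization.exists_smul_eq_mk_rep ℂ v hv
    have h := hvX _ (hscale f hf (c⁻¹ : ℂˣ) (Units.ne_zero _))
    rw [← MvPolynomial.aeval_eq_eval, aeval_bind₁, ← hc] at h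
    convert h using 2
    congr 1
    funext j
    simp [Units.smul_def]

/-- The homomorphism of polynomial rings sending the variable `j` to the monomial with exponent
`A j`. -/
noncomputable def toricHom (A : J → (W →₀ ℕ)) : MvPolynomial J ℂ →ₐ[ℂ] MvPolynomial W ℂ :=
  aeval fun j => monomial (A j) 1

/-- The exponents of the monomials that are images under `toricHom A` of monomials of degree
`t`. -/
def toricExponents (A : J → (W →₀ ℕ)) (t : ℕ) : Set (W →₀ ℕ) :=
  {w | ∃ u : J →₀ ℕ, u.degree = t ∧ u.sum (fun j k => k • A j) = w}

theorem toricHom_monomial (A : J → (W →₀ ℕ)) (u : J →₀ ℕ) :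
    toricHom A (monomial u 1) = monomial (u.sum fun j k => k • A j) 1 := by
  rw [toricHom, aeval_monomial, map_one, one_mul, Finsupp.sum, monomial_sum_one, Finsupp.prod]
  exact Finset.prod_congr rfl fun j _ => by rw [monomial_pow, one_pow]

theorem map_homogeneousSubmodule_toricHom (A : J → (W →₀ ℕ)) (t : ℕ) :
    (homogeneousSubmodule J ℂ t).map (toricHom A).toLinearMap =
      Submodule.span ℂ ((fun w => monomial w (1 : ℂ)) '' toricExponents A t) := by
  have : homogeneousSubmodule J ℂ t =
      Submodule.span ℂ ((fun u => monomial u (1 : ℂ)) '' {u : J →₀ ℕ | u.degree = t}) := by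
    rw [homogeneousSubmodule_eq_finsupp_supported, AddMonoidAlgebra.supported_eq_span_single]
    rfl
  rw [this, Submodule.map_span, ← Set.image_comp]
  congr 1
  ext p
  simp only [Set.mem_image, toricExponents, Function.comp_apply, AlgHom.toLinearMap_apply,
    toricHom_monomial, Set.mem_ofPred_eq]
  constructor
  · rintro ⟨u, hu, rfl⟩
    exact ⟨_, ⟨u, hu, rfl⟩, rfl⟩
  · rintro ⟨_, ⟨u, hu, rfl⟩, rfl⟩
    exact ⟨u, hu, rfl⟩

theorem finrank_span_monomial (S : Finset (W →₀ ℕ)) :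
    Module.finrank ℂ (Submodule.span ℂ ((fun w => monomial w (1 : ℂ)) '' (S : Set (W →₀ ℕ)))) =
      S.card := by
  have hli : LinearIndependent ℂ fun w : W →₀ ℕ => monomial w (1 : ℂ) := by
    have := (basisMonomials W ℂ).linearIndependent
    rwa [coe_basisMonomials] at this
  have := finrank_span_eq_card (hli.comp (fun w : S => (w : W →₀ ℕ)) Subtype.val_injective)
  rwa [Fintype.card_coe, Set.range_comp, Subtype.range_coe_subtype, Finset.setOfPred_mem] at this

theorem finrank_map_mk_ker {R S : Type*} [CommRing R] [CommRing S] [Algebra ℂ R] [Algebra ℂ S]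
    (f : R →ₐ[ℂ] S) {I : Ideal R} (hI : I = RingHom.ker f) (p : Submodule ℂ R) :
    Module.finrank ℂ (p.map (Ideal.Quotient.mkₐ ℂ I).toLinearMap) =
      Module.finrank ℂ (p.map f.toLinearMap) := by
  subst hI
  have h : f.toLinearMap = (Ideal.kerLiftAlg f).toLinearMap ∘ₗ
      (Ideal.Quotient.mkₐ ℂ (RingHom.ker f)).toLinearMap := by
    ext x
    rfl
  rw [h, Submodule.map_comp]
  exact (LinearEquiv.finrank_eq (Submodule.equivMapOfInjective _
    (Ideal.kerLiftAlg_injective f) _))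

/-- The vanishing ideal of the closure of the image of a monomial map is the kernel of the
corresponding homomorphism of polynomial rings. -/
theorem homVanishingIdeal_eq_ker_toricHom [Nonempty J] (A : J → (W →₀ ℕ))
    (X : Set (ℙ ℂ (J → ℂ)))
    (hX : ∀ v, v ∈ affineCone X ↔ v ≠ 0 ∧ ∃ z : W → ℂ, ∀ j, v j = eval z (monomial (A j) 1)) :
    homVanishingIdeal X = RingHom.ker (toricHom A) := by
  have heval : ∀ (z : W → ℂ) (f : MvPolynomial J ℂ),
      eval z (toricHom A f) = aeval (fun j => eval z (monomial (A j) (1 : ℂ))) f := by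
    intro z f
    rw [toricHom, ← MvPolynomial.aeval_eq_eval, ← AlgHom.comp_apply, comp_aeval]
  ext f
  rw [homVanishingIdeal, mem_vanishingIdeal_iff, RingHom.mem_ker]
  constructor
  · intro hf
    obtain ⟨j₀⟩ := ‹Nonempty J›
    -- The cone contains only nonzero vectors. Where the monomial of `j₀` is nonzero the image
    -- vector is too; elsewhere the product vanishes anyway.
    have hprod : monomial (A j₀) (1 : ℂ) * toricHom A f = 0 := by
      refine MvPolynomial.funext_iff.2 fun z => ?_
      rw [map_mul, map_zero, mul_eq_zero, or_iff_not_imp_left]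
      intro hz
      rw [heval]
      exact hf _ ((hX _).2 ⟨fun h => hz (congrFun h j₀), z, fun j => rfl⟩)
    exact (mul_eq_zero.1 hprod).resolve_left (by simp)
  · intro hf v hv
    obtain ⟨-, z, hz⟩ := (hX v).1 hv
    rw [_root_.funext hz, ← heval, hf, map_zero]

/-- The Hilbert function of a projective toric variety counts exponents. -/
theorem hilbertFunction_zariskiClosure_toric [Nonempty J] (A : J → (W →₀ ℕ))
    (X : Set (ℙ ℂ (J → ℂ)))
    (hX : ∀ v, v ∈ affineCone X ↔ v ≠ 0 ∧ ∃ z : W → ℂ, ∀ j, v j = eval z (monomial (A j) 1))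
    (t : ℕ) (S : Finset (W →₀ ℕ)) (hS : toricExponents A t = S) :
    hilbertFunction (zariskiClosure X) t = S.card := by
  rw [hilbertFunction, finrank_map_mk_ker (toricHom A)
    ((homVanishingIdeal_zariskiClosure X).trans (homVanishingIdeal_eq_ker_toricHom A X hX)),
    map_homogeneousSubmodule_toricHom, hS, finrank_span_monomial]

end Toric

/-! ### The graded semigroup of the star model. -/

section Counting

theorem toricExponents_zero {J W : Type*} (A : J → (W →₀ ℕ)) : toricExponents A 0 = {0} := by
  ext w
  constructor
  · rintro ⟨u, hu, rfl⟩
    obtain rfl := (Finsupp.degree_eq_zero_iff u).1 hu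
    rfl
  · rintro rfl
    exact ⟨0, map_zero _, rfl⟩

theorem mem_toricExponents_succ {J W : Type*} (A : J → (W →₀ ℕ)) (t : ℕ) (w : W →₀ ℕ) :
    w ∈ toricExponents A (t + 1) ↔ ∃ j, ∃ w' ∈ toricExponents A t, w = w' + A j := by
  classical
  have hadd : ∀ (u : J →₀ ℕ) (j : J), (u + Finsupp.single j 1).sum (fun j k => k • A j) =
      u.sum (fun j k => k • A j) + A j := by
    intro u j
    rw [Finsupp.sum_add_index' (h := fun j k => k • A j) (fun _ => zero_smul ..)
      (fun _ _ _ => add_smul ..), Finsupp.sum_single_index (h := fun j k => k • A j)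
      (zero_smul ..), one_smul]
  constructor
  · rintro ⟨u, hu, rfl⟩
    obtain ⟨j, hj⟩ : ∃ j, u j ≠ 0 := by
      by_contra! h
      obtain rfl : u = 0 := Finsupp.ext h
      simp at hu
    have hle : Finsupp.single j 1 ≤ u := Finsupp.single_le_iff.2 (Nat.one_le_iff_ne_zero.2 hj)
    have hsub := tsub_add_cancel_of_le hle
    refine ⟨j, _, ⟨u - Finsupp.single j 1, ?_, rfl⟩, ?_⟩
    · rw [← hsub, map_add, Finsupp.degree_single] at hu
      omega
    · rw [← hadd, hsub]
  · rintro ⟨j, _, ⟨u, rfl, rfl⟩, rfl⟩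
    exact ⟨u + Finsupp.single j 1, by simp, hadd u j⟩

variable {m : ℕ} (d : Fin (m + 1) → ℕ)

/-- The parameters of the star model: one for each state of the center and one for each joint
state of the center and a leaf. -/
abbrev StarParameter : Type := Fin (d 0) ⊕ (Fin (d 0) × Σ i : Fin m, Fin (d i.succ))

/-- The exponent of the monomial parametrizing the coordinate at the joint state `j`. -/
noncomputable def starExponent (j : ∀ i, Fin (d i)) : StarParameter d →₀ ℕ :=
  Finsupp.single (Sum.inl (j 0)) 1 + ∑ i, Finsupp.single (Sum.inr (j 0, ⟨i, j i.succ⟩)) 1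

theorem starExponent_inl (j : ∀ i, Fin (d i)) (a : Fin (d 0)) :
    starExponent d j (Sum.inl a) = if j 0 = a then 1 else 0 := by
  simp [starExponent, Finsupp.single_apply]

theorem starExponent_inr (j : ∀ i, Fin (d i)) (a : Fin (d 0)) (i : Fin m)
    (b : Fin (d i.succ)) :
    starExponent d j (Sum.inr (a, ⟨i, b⟩)) = if j 0 = a ∧ j i.succ = b then 1 else 0 := by
  classical
  simp only [starExponent, Finsupp.add_apply, Finsupp.finsetSum_apply, Finsupp.single_apply,
    reduceCtorEq, if_false, zero_add, Sum.inr.injEq, Prod.mk.injEq, Sigma.mk.injEq]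
  rw [Finset.sum_eq_single i]
  · simp
  · intro k _ hk
    simp [hk]
  · simp

theorem sum_starExponent_inl (j : ∀ i, Fin (d i)) :
    ∑ a, starExponent d j (Sum.inl a) = 1 := by
  simp [starExponent_inl]

theorem sum_starExponent_inr (j : ∀ i, Fin (d i)) (a : Fin (d 0)) (i : Fin m) :
    ∑ b, starExponent d j (Sum.inr (a, ⟨i, b⟩)) = starExponent d j (Sum.inl a) := by
  simp only [starExponent_inl, starExponent_inr]
  by_cases h : j 0 = a <;> simp [h]

/-- For sufficiency, induct on `t`: some center state `a` has a positive count, so by balance every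
leaf has a state counted together with `a`. Subtracting the resulting generator preserves balance.
-/
theorem mem_toricExponents_starExponent (t : ℕ) (w : StarParameter d →₀ ℕ) :
    w ∈ toricExponents (starExponent d) t ↔ ∑ a, w (Sum.inl a) = t ∧
      ∀ a i, ∑ b, w (Sum.inr (a, ⟨i, b⟩)) = w (Sum.inl a) := by
  induction t generalizing w with
  | zero =>
    rw [toricExponents_zero, Set.mem_singleton_iff]
    constructor
    · rintro rfl
      simp
    · rintro ⟨h0, h1⟩
      simp only [Finset.sum_eq_zero_iff, Finset.mem_univ, true_implies] at h0
      ext (a | ⟨a, i, b⟩)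
      · exact h0 a
      · have := h1 a i
        rw [h0 a] at this
        simp only [Finset.sum_eq_zero_iff, Finset.mem_univ, true_implies] at this
        exact this b
  | succ t ih =>
    rw [mem_toricExponents_succ]
    constructor
    · rintro ⟨j, w', hw', rfl⟩
      obtain ⟨h0, h1⟩ := (ih w').1 hw'
      simp only [Finsupp.add_apply, Finset.sum_add_distrib, sum_starExponent_inl,
        sum_starExponent_inr, h0, h1, implies_true, and_self]
    · rintro ⟨h0, h1⟩
      obtain ⟨a, ha⟩ : ∃ a, w (Sum.inl a) ≠ 0 := by
        by_contra! h
        simp [h] at h0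
      have hb : ∀ i, ∃ b, w (Sum.inr (a, ⟨i, b⟩)) ≠ 0 := by
        intro i
        by_contra! h
        have := h1 a i
        simp only [h, Finset.sum_const_zero] at this
        exact ha this.symm
      choose b hb using hb
      have hle : starExponent d (Fin.cons a b) ≤ w := by
        rintro (a' | ⟨a', i, b'⟩)
        · rw [starExponent_inl, Fin.cons_zero]
          split_ifs with h
          · subst h; omega
          · exact Nat.zero_le _
        · rw [starExponent_inr, Fin.cons_zero, Fin.cons_succ]
          split_ifs with h
          · obtain ⟨rfl, rfl⟩ := h
            have := hb i
            omega
          · exact Nat.zero_le _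
      refine ⟨Fin.cons a b, w - starExponent d (Fin.cons a b), (ih _).2 ?_,
        (tsub_add_cancel_of_le hle).symm⟩
      rw [← tsub_add_cancel_of_le hle] at h0 h1
      simp only [Finsupp.add_apply, Finset.sum_add_distrib, sum_starExponent_inl,
        sum_starExponent_inr] at h0 h1
      exact ⟨by omega, fun a' i => by have := h1 a' i; omega⟩

/-- A family of exponents, given by a vector indexed by the states of the center and vectors for
all leaves, as a single exponent. -/
noncomputable def glueExponent (x : Σ _ : Fin (d 0) →₀ ℕ,
    Fin (d 0) → ∀ i : Fin m, Fin (d i.succ) →₀ ℕ) : StarParameter d →₀ ℕ :=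
  Finsupp.equivFunOnFinite.symm (Sum.elim x.1 fun p => x.2 p.1 p.2.1 p.2.2)

theorem glueExponent_injective : Function.Injective (glueExponent d) := by
  rintro ⟨l, g⟩ ⟨l', g'⟩ h
  have h' := Finsupp.equivFunOnFinite.symm.injective h
  obtain rfl : l = l' := Finsupp.ext fun a => congrFun h' (Sum.inl a)
  obtain rfl : g = g' := by
    funext a i
    ext b
    exact congrFun h' (Sum.inr (a, ⟨i, b⟩))
  rfl

/-- The exponents of degree `t` in the semigroup of the star model. -/
noncomputable def starExponents (t : ℕ) : Finset (StarParameter d →₀ ℕ) :=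
  ((Finset.finsuppAntidiag Finset.univ t).sigma fun l => Fintype.piFinset fun a =>
    Fintype.piFinset fun _ => Finset.finsuppAntidiag Finset.univ (l a)).map
      ⟨glueExponent d, glueExponent_injective d⟩

theorem toricExponents_starExponent (t : ℕ) :
    toricExponents (starExponent d) t = starExponents d t := by
  ext w
  rw [mem_toricExponents_starExponent, Finset.mem_coe, starExponents, Finset.mem_map]
  simp only [Finset.mem_sigma, Fintype.mem_piFinset, Finset.mem_finsuppAntidiag,
    Finset.subset_univ, and_true, Function.Embedding.coeFn_mk]
  constructor
  · rintro ⟨h0, h1⟩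
    refine ⟨⟨Finsupp.equivFunOnFinite.symm fun a => w (Sum.inl a), fun a i =>
      Finsupp.equivFunOnFinite.symm fun b => w (Sum.inr (a, ⟨i, b⟩))⟩, ⟨h0, h1⟩, ?_⟩
    ext (a | ⟨a, i, b⟩) <;> rfl
  · rintro ⟨⟨l, g⟩, ⟨h0, h1⟩, rfl⟩
    exact ⟨h0, h1⟩

/-- Expanding the power of the series sums over the same vectors `l`; each leaf contributes a
stars-and-bars count. -/
theorem card_starExponents (hd : ∀ i, 1 ≤ d i) (t : ℕ) :
    ((starExponents d t).card : ℚ) = PowerSeries.coeff t ((PowerSeries.mk fun s : ℕ =>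
      ∏ i : Fin m, ((s + (d i.succ - 1)).choose (d i.succ - 1) : ℚ)) ^ d 0) := by
  have hpow : ∀ F : PowerSeries ℚ, F ^ d 0 = ∏ _a : Fin (d 0), F := fun F => by simp
  rw [hpow, PowerSeries.coeff_prod, starExponents, Finset.card_map, Finset.card_sigma,
    Nat.cast_sum]
  refine Finset.sum_congr rfl fun l _ => ?_
  rw [Fintype.card_piFinset, Nat.cast_prod]
  refine Finset.prod_congr rfl fun a _ => ?_
  rw [Fintype.card_piFinset, Nat.cast_prod, PowerSeries.coeff_mk]
  refine Finset.prod_congr rfl fun i _ => ?_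
  rw [Finset.card_finsuppAntidiag_nat_eq_choose, Finset.card_univ, Fintype.card_fin]
  have := hd i.succ
  rw [show d i.succ + l a - 1 = l a + (d i.succ - 1) by omega, Nat.choose_symm_add]

end Counting

/-! ### Maximal cliques of the star and its parametrization. -/

section Star

variable {m : ℕ}

theorem isClique_star_pair (i : Fin m) :
    (SimpleGraph.starGraph (0 : Fin (m + 1))).IsClique
      (({0, i.succ} : Finset (Fin (m + 1))) : Set (Fin (m + 1))) := by
  intro x hx y hy hxy
  simp only [Finset.coe_insert, Finset.coe_singleton, Set.mem_insert_iff,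
    Set.mem_singleton_iff] at hx hy
  rw [SimpleGraph.starGraph_adj]
  grind

theorem subset_pair_of_isClique_star {C : Finset (Fin (m + 1))}
    (hC : (SimpleGraph.starGraph (0 : Fin (m + 1))).IsClique (C : Set (Fin (m + 1))))
    {i : Fin m} (hi : i.succ ∈ C) : C ⊆ {0, i.succ} := by
  intro x hx
  by_contra h
  simp only [Finset.mem_insert, Finset.mem_singleton, not_or] at h
  have := hC (Finset.mem_coe.2 hx) (Finset.mem_coe.2 hi) h.2
  rw [SimpleGraph.starGraph_adj] at this
  exact this.2.elim h.1 (Fin.succ_ne_zero i)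

theorem maximalCliques_star (hm : 0 < m) :
    maximalCliques (SimpleGraph.starGraph (0 : Fin (m + 1))) =
      Finset.univ.image fun i : Fin m => ({0, i.succ} : Finset (Fin (m + 1))) := by
  ext C
  simp only [maximalCliques, Finset.mem_filter, Finset.mem_univ, true_and, Finset.mem_image]
  constructor
  · intro hC
    by_cases h : ∃ i : Fin m, i.succ ∈ C
    · obtain ⟨i, hi⟩ := h
      exact ⟨i, hC.eq_of_ge (isClique_star_pair i)
        (subset_pair_of_isClique_star hC.prop hi)⟩
    -- A clique without leaves lies in every edge; the first one exists by `hm`.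
    · have hsub : C ⊆ {0, (⟨0, hm⟩ : Fin m).succ} := by
        intro x hx
        induction x using Fin.cases with
        | zero => simp
        | succ i => exact absurd ⟨i, hx⟩ h
      exact ⟨_, hC.eq_of_ge (isClique_star_pair _) hsub⟩
  · rintro ⟨i, rfl⟩
    refine ⟨isClique_star_pair i, fun T hT hle => ?_⟩
    exact subset_pair_of_isClique_star hT (hle (by simp))

theorem maximalCliques_star_one :
    maximalCliques (SimpleGraph.starGraph (0 : Fin 1)) = {{0}} := by
  ext C
  simp only [maximalCliques, Finset.mem_filter, Finset.mem_univ, true_and, Finset.mem_singleton]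
  have huniv : ({0} : Finset (Fin 1)) = Finset.univ := rfl
  have hcl : (SimpleGraph.starGraph (0 : Fin 1)).IsClique
      (({0} : Finset (Fin 1)) : Set (Fin 1)) := by
    simp
  constructor
  · intro hC
    exact (hC.eq_of_ge hcl (by rw [huniv]; exact Finset.subset_univ C)).symm
  · rintro rfl
    exact ⟨hcl, fun T _ _ => by rw [huniv]; exact Finset.subset_univ T⟩

variable (d : Fin (m + 1) → ℕ)

/-- The monomial parametrization of the star model with an extra parameter for each state of the
center. -/
noncomputable def starParam (z : StarParameter d → ℂ) (j : ∀ i, Fin (d i)) : ℂ :=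
  z (Sum.inl (j 0)) * ∏ i : Fin m, z (Sum.inr (j 0, ⟨i, j i.succ⟩))

theorem eval_monomial_starExponent (z : StarParameter d → ℂ) (j : ∀ i, Fin (d i)) :
    MvPolynomial.eval z (MvPolynomial.monomial (starExponent d j) 1) = starParam d z j := by
  have hsum : ∀ (s : StarParameter d), MvPolynomial.eval z
      (MvPolynomial.monomial (Finsupp.single s 1) 1) = z s := fun s => MvPolynomial.eval_X s
  rw [starExponent, ← one_mul (1 : ℂ), ← MvPolynomial.monomial_mul, map_mul, hsum,
    MvPolynomial.monomial_sum_one, map_prod, starParam]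
  simp only [hsum]

theorem monomialParam_star (hm : 0 < m) (s : ∀ C : Finset (Fin (m + 1)), CliqueState d C → ℂ)
    (j : ∀ i, Fin (d i)) :
    monomialParam d (SimpleGraph.starGraph (0 : Fin (m + 1))) s j =
      ∏ i : Fin m, s {0, i.succ} fun k => j k := by
  rw [monomialParam, maximalCliques_star hm, Finset.prod_image]
  intro i _ k _ h
  have hi : i.succ ∈ ({0, k.succ} : Finset (Fin (m + 1))) := by
    have h' : ({0, i.succ} : Finset (Fin (m + 1))) = {0, k.succ} := h
    rw [← h']
    simp
  simpa [Fin.succ_ne_zero] using hi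

theorem exists_starParam_of_monomialParam (hd : ∀ i, 1 ≤ d i)
    (s : ∀ C : Finset (Fin (m + 1)), CliqueState d C → ℂ) :
    ∃ z, monomialParam d (SimpleGraph.starGraph (0 : Fin (m + 1))) s = starParam d z := by
  rcases Nat.eq_zero_or_pos m with rfl | hm
  · refine ⟨Sum.elim (fun a => s {0} fun k => Fin.cons (α := fun k => Fin (d k)) a
      (fun i => i.elim0) k) fun _ => 1, ?_⟩
    funext j
    rw [monomialParam, maximalCliques_star_one, Finset.prod_singleton, starParam]
    simp only [Sum.elim_inl, Finset.univ_eq_empty, Finset.prod_empty, mul_one]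
    congr 1
    funext ⟨k, hk⟩
    obtain rfl := Finset.mem_singleton.1 hk
    rfl
  -- With leaves present the extra center parameters are set to 1. The filler state 0 at the other
  -- leaves is never read by the clique.
  · refine ⟨Sum.elim (fun _ => 1) fun p => s {0, p.2.1.succ} fun k =>
      Function.update (β := fun k => Fin (d k)) (Fin.cons p.1 fun i => ⟨0, hd i.succ⟩)
        p.2.1.succ p.2.2 k, ?_⟩
    funext j
    rw [monomialParam_star d hm, starParam]
    simp only [Sum.elim_inl, Sum.elim_inr, one_mul]
    refine Finset.prod_congr rfl fun i _ => ?_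
    congr 1
    funext ⟨k, hk⟩
    simp only [Finset.mem_insert, Finset.mem_singleton] at hk
    rcases hk with rfl | rfl
    · rw [Function.update_of_ne (Fin.succ_ne_zero i).symm, Fin.cons_zero]
    · rw [Function.update_self]

theorem exists_monomialParam_of_starParam (z : StarParameter d → ℂ) :
    ∃ s, monomialParam d (SimpleGraph.starGraph (0 : Fin (m + 1))) s = starParam d z := by
  classical
  rcases Nat.eq_zero_or_pos m with rfl | hm
  · refine ⟨fun C x => if h : 0 ∈ C then z (Sum.inl (x ⟨0, h⟩)) else 1, ?_⟩
    funext j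
    rw [monomialParam, maximalCliques_star_one, Finset.prod_singleton, starParam]
    simp
  -- The center parameter is absorbed into the edge of the first leaf. The product over leaves in
  -- `C` reads off the leaf of an edge: it has a single nontrivial factor.
  · refine ⟨fun C x => if h : 0 ∈ C then ∏ i : Fin m, if hi : i.succ ∈ C then
      (if i = ⟨0, hm⟩ then z (Sum.inl (x ⟨0, h⟩)) else 1) *
        z (Sum.inr (x ⟨0, h⟩, ⟨i, x ⟨i.succ, hi⟩⟩)) else 1 else 1, ?_⟩
    funext j
    rw [monomialParam_star d hm, starParam]
    have : ∀ i : Fin m, (if _h : (0 : Fin (m + 1)) ∈ ({0, i.succ} : Finset (Fin (m + 1))) then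
        ∏ k : Fin m, (if _hk : k.succ ∈ ({0, i.succ} : Finset (Fin (m + 1))) then
          (if k = ⟨0, hm⟩ then z (Sum.inl (j 0)) else 1) *
            z (Sum.inr (j 0, ⟨k, j k.succ⟩)) else 1) else 1) =
        (if i = ⟨0, hm⟩ then z (Sum.inl (j 0)) else 1) *
          z (Sum.inr (j 0, ⟨i, j i.succ⟩)) := by
      intro i
      rw [dif_pos (by simp), Finset.prod_eq_single i]
      · rw [dif_pos (by simp)]
      · intro k _ hk
        rw [dif_neg (by simpa [Fin.succ_ne_zero] using hk)]
      · simp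
    rw [Finset.prod_congr rfl fun i _ => this i, Finset.prod_mul_distrib, Finset.prod_ite_eq']
    simp

theorem mem_affineCone_factorizesAccordingTo_star (hd : ∀ i, 1 ≤ d i)
    (v : (∀ i, Fin (d i)) → ℂ) :
    v ∈ affineCone {p | FactorizesAccordingTo d (SimpleGraph.starGraph (0 : Fin (m + 1))) p} ↔
      v ≠ 0 ∧ ∃ z, v = starParam d z := by
  constructor
  · rintro ⟨hv, s, hs, h⟩
    refine ⟨hv, ?_⟩
    obtain ⟨c, rfl⟩ := (Projectivization.mk_eq_mk_iff' ℂ _ _ hv hs).1 h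
    obtain ⟨z, hz⟩ := exists_starParam_of_monomialParam d hd s
    -- Each coordinate contains exactly one center parameter, so these absorb the projective scalar.
    refine ⟨Sum.elim (fun a => c * z (Sum.inl a)) fun p => z (Sum.inr p), ?_⟩
    funext j
    simp [hz, starParam, mul_assoc]
  · rintro ⟨hv, z, rfl⟩
    obtain ⟨s, hs⟩ := exists_monomialParam_of_starParam d z
    exact ⟨hv, s, hs ▸ hv, by simp only [hs]⟩

end Star

end GraphicalDegree

theorem corollaryA13 (m : ℕ) (d : Fin (m + 1) → ℕ) (hd : ∀ i, 1 ≤ d i) :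
    GraphicalDegree.HasDegree
      (GraphicalDegree.graphicalModel d (SimpleGraph.starGraph (0 : Fin (m + 1))))
      ((((∑ i : Fin m, (d i.succ - 1)) ! : ℚ) / ∏ i : Fin m, ((d i.succ - 1) ! : ℚ)) ^ d 0) := by
  obtain ⟨P, hP, hlead⟩ := GraphicalDegree.exists_polynomial_coeff_pow
    (fun i : Fin m => d i.succ - 1) (d 0) (Nat.one_le_iff_ne_zero.1 (hd 0))
  refine ⟨P, hP.mono fun t ht => ?_, hlead⟩
  have : Nonempty (∀ i, Fin (d i)) := ⟨fun i => ⟨0, hd i⟩⟩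
  rw [ht, GraphicalDegree.graphicalModel,
    GraphicalDegree.hilbertFunction_zariskiClosure_toric (GraphicalDegree.starExponent d) _
      (fun v => ?_) t _ (GraphicalDegree.toricExponents_starExponent d t),
    GraphicalDegree.card_starExponents d hd t]
  rw [GraphicalDegree.mem_affineCone_factorizesAccordingTo_star d hd]
  simp only [GraphicalDegree.eval_monomial_starExponent, funext_iff]
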